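/- Let $G$ be a finite simple connected graph that contains a cycle, let $g$ be its girth (the length of a shortest cycle of $G$), and let $n(G)$ be its negative inertia index, i.e. the number of negative eigenvalues, counted with multiplicity, of the adjacency matrix of $G$. Then $n(G) \ge \lceil g/2 \rceil - 1$. Equality holds if and only if $G$ is isomorphic to a cycle $C_n$ with $n \ge 3$ and $n \equiv 0$ or $1 \pmod 4$, or to a complete bipartite graph $K_{s,t}$ with $s,t \ge 1$ and $s+t \ge 5$ (where necessarily $s,t \ge 2$, since $G$ contains a cycle). -/

import Mathlib

/-- The negative inertia index `n(G)` of a finite simple graph `G`: the number of negative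
eigenvalues, counted with multiplicity, of its real adjacency matrix. -/
noncomputable def SimpleGraph.negInertia {V : Type*} [Fintype V] [DecidableEq V]
    (G : SimpleGraph V) [DecidableRel G.Adj] : ℕ :=
  Fintype.card {i : V // (G.isHermitian_adjMatrix ℝ).eigenvalues i < 0}

/-!
The negative inertia index is the largest dimension of a space on which the adjacency form
`x ↦ ⟨x, A x⟩` is negative definite (`finrank_le_negInertia`, `exists_negDef_linearMap`), so it is
monotone under induced subgraphs (`negInertia_le_of_embedding`). Lower bounds come from one
construction: if `a i` is adjacent to `b i` for `i < m`, the `a i` are pairwise non-adjacent, and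
`a i` is not adjacent to `b j` for `i < j`, then the form on the span of these vertices has the
shape `[0, B; Bᵀ, D]` with `B` unitriangular, which forces `m` negative eigenvalues
(`le_negInertia_of_triangular`).

A shortest cycle is an induced copy of `C_g` (`Walk.IsCycle.exists_embedding`). Alternate edges of
`C_g` minus a vertex form a triangular family of size `⌈g/2⌉ - 1 = ⌊(g-1)/2⌋`, which is the bound.
For `g ≡ 2, 3 (mod 4)` an explicit sign vector orthogonal to that family gives one more negative
eigenvalue (`lt_negInertia_cycleGraph`), so equality needs `g ≡ 0, 1 (mod 4)`, and for those values
`C_g` attains the bound (`negInertia_cycleGraph_le`).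

If `G` is not the cycle itself, then, by connectedness, some vertex outside a shortest cycle is
attached to it. When `g ≥ 5` it has exactly one neighbour on the cycle, and the pendant edge
enlarges the triangular family (`Walk.IsCycle.lt_negInertia_of_adj`), so equality fails. When
`g = 4`, equality means a single negative eigenvalue, and a triangle-free connected graph with this
property is complete bipartite (`exists_iso_completeBipartiteGraph`). Conversely the form of
`K_{s,t}` is `2 (∑ x)(∑ y)`, so it has at most one negative eigenvalue; the lower bounds then
leave `4` as the only possible girth.
-/

open Matrix

/-! ### Negative inertia and the quadratic form of the adjacency matrix -/

theorem Matrix.IsHermitian.dotProduct_mulVec_eq_sum_eigenvalues {n : Type*} [Fintype n]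
    [DecidableEq n] {A : Matrix n n ℝ} (hA : A.IsHermitian) (x : n → ℝ) :
    x ⬝ᵥ A *ᵥ x =
      ∑ i, hA.eigenvalues i * (hA.eigenvectorUnitary.1ᵀ *ᵥ x) i ^ 2 := by
  set U : Matrix n n ℝ := hA.eigenvectorUnitary.1
  have hs : A = U * diagonal hA.eigenvalues * Uᵀ := by
    have h := hA.spectral_theorem
    rw [Unitary.conjStarAlgAut_apply] at h
    simpa [U, star_eq_conjTranspose, Function.comp_def] using h
  have hx : x ⬝ᵥ A *ᵥ x = (Uᵀ *ᵥ x) ⬝ᵥ (diagonal hA.eigenvalues *ᵥ (Uᵀ *ᵥ x)) := by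
    conv_lhs => rw [hs]
    rw [← mulVec_mulVec, ← mulVec_mulVec, dotProduct_mulVec, ← mulVec_transpose]
  rw [hx, dotProduct]
  refine Finset.sum_congr rfl fun i _ ↦ ?_
  rw [mulVec_diagonal]
  ring

namespace SimpleGraph

section Inertia

variable {V : Type*} [Fintype V] [DecidableEq V] (G : SimpleGraph V) [DecidableRel G.Adj]

/-- A space on which the adjacency form is negative definite has dimension at most the negative
inertia index: it projects injectively to the span of the eigenvectors with negative eigenvalue. -/
theorem finrank_le_negInertia {E : Type*} [AddCommGroup E] [Module ℝ E]
    (L : E →ₗ[ℝ] V → ℝ) (hL : ∀ y, y ≠ 0 → L y ⬝ᵥ G.adjMatrix ℝ *ᵥ L y < 0) :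
    Module.finrank ℝ E ≤ G.negInertia := by
  let T : E →ₗ[ℝ] {i : V // (G.isHermitian_adjMatrix ℝ).eigenvalues i < 0} → ℝ :=
    (LinearMap.funLeft ℝ ℝ Subtype.val) ∘ₗ
      (G.isHermitian_adjMatrix ℝ).eigenvectorUnitary.1ᵀ.mulVecLin ∘ₗ L
  have hT : Function.Injective T := by
    rw [← LinearMap.ker_eq_bot, LinearMap.ker_eq_bot']
    intro y hy
    by_contra hne
    refine (hL y hne).not_ge ?_
    rw [(G.isHermitian_adjMatrix ℝ).dotProduct_mulVec_eq_sum_eigenvalues]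
    refine Finset.sum_nonneg fun i _ ↦ ?_
    by_cases hi : (G.isHermitian_adjMatrix ℝ).eigenvalues i < 0
    · have := congrFun hy ⟨i, hi⟩
      simp only [T, LinearMap.comp_apply, LinearMap.funLeft_apply, mulVecLin_apply,
        Pi.zero_apply] at this
      simp [this]
    · exact mul_nonneg (not_lt.mp hi) (sq_nonneg _)
  simpa [negInertia] using LinearMap.finrank_le_finrank_of_injective hT

/-- The span of the eigenvectors with negative eigenvalue is a space of dimension `G.negInertia` on
which the adjacency form is negative definite. -/
theorem exists_negDef_linearMap :
    ∃ L : (Fin G.negInertia → ℝ) →ₗ[ℝ] V → ℝ,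
      ∀ y, y ≠ 0 → L y ⬝ᵥ G.adjMatrix ℝ *ᵥ L y < 0 := by
  set hA := G.isHermitian_adjMatrix ℝ
  set U : Matrix V V ℝ := hA.eigenvectorUnitary.1
  have hU : Uᵀ * U = 1 := by
    have := Unitary.coe_star_mul_self hA.eigenvectorUnitary
    simpa [star_eq_conjTranspose] using this
  let ι := {i : V // hA.eigenvalues i < 0}
  let e : ι ≃ Fin G.negInertia := Fintype.equivFin ι
  let S : (ι → ℝ) →ₗ[ℝ] V → ℝ := Function.ExtendByZero.linearMap ℝ (Subtype.val : ι → V)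
  have hS (y : ι → ℝ) (i : ι) : S y i = y i := Subtype.val_injective.extend_apply _ _ _
  have hS' (y : ι → ℝ) (i : V) (hi : ¬ hA.eigenvalues i < 0) : S y i = 0 :=
    Function.extend_apply' _ _ _ (by rintro ⟨j, rfl⟩; exact hi j.2)
  refine ⟨U.mulVecLin ∘ₗ S ∘ₗ LinearMap.funLeft ℝ ℝ e, fun y hy ↦ ?_⟩
  rw [hA.dotProduct_mulVec_eq_sum_eigenvalues]
  simp only [LinearMap.comp_apply, mulVecLin_apply]
  change ∑ i, hA.eigenvalues i * (Uᵀ *ᵥ (U *ᵥ S (y ∘ e))) i ^ 2 < 0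
  rw [mulVec_mulVec, hU, one_mulVec]
  obtain ⟨j, hj⟩ := Function.ne_iff.mp hy
  refine Finset.sum_neg' (fun i _ ↦ ?_) ⟨e.symm j, Finset.mem_univ _, ?_⟩
  · by_cases hi : hA.eigenvalues i < 0
    · exact mul_nonpos_of_nonpos_of_nonneg hi.le (sq_nonneg _)
    · simp [hS' _ i hi]
  · rw [hS]
    refine mul_neg_of_neg_of_pos (e.symm j).2 ?_
    have : y j ≠ 0 := hj
    simp only [Function.comp_apply, Equiv.apply_symm_apply]
    positivity

/-- If the adjacency form is nonnegative on the common kernel of `k` linear functionals, then the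
negative inertia index is at most `k`. -/
theorem negInertia_le_of_ker {k : ℕ} (φ : (V → ℝ) →ₗ[ℝ] Fin k → ℝ)
    (hφ : ∀ x, φ x = 0 → 0 ≤ x ⬝ᵥ G.adjMatrix ℝ *ᵥ x) : G.negInertia ≤ k := by
  obtain ⟨L, hL⟩ := G.exists_negDef_linearMap
  have hT : Function.Injective (φ ∘ₗ L) := by
    rw [← LinearMap.ker_eq_bot, LinearMap.ker_eq_bot']
    intro y hy
    by_contra hne
    exact (hL y hne).not_ge (hφ _ hy)
  simpa using LinearMap.finrank_le_finrank_of_injective hT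

variable {G}

/-- The negative inertia index is monotone under induced subgraphs. -/
theorem negInertia_le_of_embedding {W : Type*} [Fintype W] [DecidableEq W] {H : SimpleGraph W}
    [DecidableRel H.Adj] (f : H ↪g G) : H.negInertia ≤ G.negInertia := by
  obtain ⟨L, hL⟩ := H.exists_negDef_linearMap
  have hS (x : W → ℝ) (i : W) : Function.extend f x 0 (f i) = x i := f.injective.extend_apply _ _ _
  have hsum (x : W → ℝ) (g : V → ℝ) :
      ∑ v, Function.extend f x 0 v * g v = ∑ i, x i * g (f i) := by
    rw [← Fintype.sum_of_injective f f.injective (fun i ↦ x i * g (f i))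
      (fun v ↦ Function.extend f x 0 v * g v)]
    · intro v hv
      rw [Function.extend_apply' _ _ _ (by simpa using hv)]
      simp
    · intro i
      rw [hS]
  have hform (x : W → ℝ) : Function.extend f x 0 ⬝ᵥ G.adjMatrix ℝ *ᵥ Function.extend f x 0 =
      x ⬝ᵥ H.adjMatrix ℝ *ᵥ x := by
    simp only [dotProduct, mulVec]
    rw [hsum x]
    refine Finset.sum_congr rfl fun i _ ↦ ?_
    simp_rw [mul_comm (G.adjMatrix ℝ _ _)]
    rw [hsum x]
    simp [adjMatrix_apply, mul_comm, f.map_adj_iff]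
  simpa using G.finrank_le_negInertia (Function.ExtendByZero.linearMap ℝ f ∘ₗ L)
    fun y hy ↦ (hform (L y)).trans_lt (hL y hy)

theorem negInertia_eq_of_iso {W : Type*} [Fintype W] [DecidableEq W] {H : SimpleGraph W}
    [DecidableRel H.Adj] (f : H ≃g G) : H.negInertia = G.negInertia :=
  le_antisymm (negInertia_le_of_embedding f.toEmbedding)
    (negInertia_le_of_embedding f.symm.toEmbedding)

end Inertia

/-! ### Negative definite spaces from triangular families of edges -/

section Triangular

variable {V : Type*} [Fintype V] [DecidableEq V] {G : SimpleGraph V} [DecidableRel G.Adj]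

/-- The basic lower-bound construction: a parametrized `m`-dimensional space, supported on the
vertices `a i` and `b i`, on which the adjacency form is minus the standard one. Being supported
there is expressed by orthogonality to every `u` that vanishes at these vertices. -/
theorem exists_linearMap_of_triangular {m : ℕ} (a b : Fin m → V)
    (haa : ∀ i j, ¬ G.Adj (a i) (a j)) (hab : ∀ i, G.Adj (a i) (b i))
    (htri : ∀ i j, i < j → ¬ G.Adj (a i) (b j)) :
    ∃ L : (Fin m → ℝ) →ₗ[ℝ] V → ℝ,
      (∀ y, L y ⬝ᵥ G.adjMatrix ℝ *ᵥ L y = -(y ⬝ᵥ y)) ∧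
      ∀ u : V → ℝ, (∀ i, u (a i) = 0) → (∀ i, u (b i) = 0) → ∀ y, L y ⬝ᵥ u = 0 := by
  set A := G.adjMatrix ℝ with hA
  let B : Matrix (Fin m) (Fin m) ℝ := A.submatrix a b
  let D : Matrix (Fin m) (Fin m) ℝ := A.submatrix b b
  let P : Matrix (Fin m) V ℝ := (1 : Matrix V V ℝ).submatrix a id
  let Q : Matrix (Fin m) V ℝ := (1 : Matrix V V ℝ).submatrix b id
  have hP (f : Fin m → V) (u : V → ℝ) (i) :
      ((1 : Matrix V V ℝ).submatrix f id *ᵥ u) i = u (f i) := by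
    simp [mulVec, dotProduct, one_apply]
  have hPA (f g : Fin m → V) : (1 : Matrix V V ℝ).submatrix f id * A *
      ((1 : Matrix V V ℝ).submatrix g id)ᵀ = A.submatrix f g := by
    ext i j
    simp [mul_apply, one_apply]
  have hPAP : P * A * Pᵀ = 0 := by
    rw [hPA]
    ext i j
    simp [hA, haa]
  have hPAQ : P * A * Qᵀ = B := hPA a b
  have hQAP : Q * A * Pᵀ = Bᵀ := by
    rw [hPA]
    ext i j
    simp [B, hA, G.adj_comm]
  have hQAQ : Q * A * Qᵀ = D := hPA b b
  have hB : IsUnit Bᵀ.det := by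
    rw [det_transpose, det_of_isLowerTriangular B fun i j hij ↦ by
      simp [B, hA, htri i j (by simpa using hij)]]
    simp [B, hA, hab]
  -- With `x` the coefficients on the `a i`, the form is `2 ⟨Bᵀ x, y⟩ + ⟨y, D y⟩`; the choice
  -- `Bᵀ x = -(y + D y) / 2` turns it into `-⟨y, y⟩`.
  let M : Matrix (Fin m) (Fin m) ℝ := -(1 / 2 : ℝ) • (Bᵀ⁻¹ * (1 + D))
  have hBM : Bᵀ * M = -(1 / 2 : ℝ) • (1 + D) := by
    simp only [M]
    rw [mul_smul_comm, mul_nonsing_inv_cancel_left _ _ hB]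
  refine ⟨(Pᵀ * M + Qᵀ).mulVecLin, fun y ↦ ?_, fun u ha hb y ↦ ?_⟩
  · have key : (Pᵀ * M + Qᵀ)ᵀ * A * (Pᵀ * M + Qᵀ) = Mᵀ * B + (Bᵀ * M + D) := by
      have : (Pᵀ * M + Qᵀ)ᵀ * A * (Pᵀ * M + Qᵀ) =
          Mᵀ * (P * A * Pᵀ) * M + Mᵀ * (P * A * Qᵀ) + (Q * A * Pᵀ) * M + Q * A * Qᵀ := by
        simp only [transpose_add, transpose_mul, transpose_transpose, Matrix.add_mul,
          Matrix.mul_add, Matrix.mul_assoc]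
        abel
      rw [this, hPAP, hPAQ, hQAP, hQAQ]
      simp [add_assoc]
    have hD : Dᵀ = D := by
      ext i j
      simp [D, hA, G.adj_comm]
    have hMB : Mᵀ * B = -(1 / 2 : ℝ) • (1 + D) := by
      have := congrArg transpose hBM
      simpa [hD] using this
    have hform : (Pᵀ * M + Qᵀ)ᵀ * A * (Pᵀ * M + Qᵀ) = -1 := by
      rw [key, hMB, hBM]
      module
    rw [mulVecLin_apply, mulVec_mulVec, dotProduct_mulVec, ← vecMul_transpose, vecMul_vecMul,
      ← Matrix.mul_assoc, hform, vecMul_neg, vecMul_one, neg_dotProduct]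
  · have hPu : P *ᵥ u = 0 := funext fun i ↦ (hP a u i).trans (ha i)
    have hQu : Q *ᵥ u = 0 := funext fun i ↦ (hP b u i).trans (hb i)
    rw [mulVecLin_apply, dotProduct_comm, dotProduct_mulVec, ← mulVec_transpose, transpose_add,
      transpose_mul, transpose_transpose, transpose_transpose, add_mulVec, ← mulVec_mulVec, hPu,
      hQu]
    simp

theorem le_negInertia_of_triangular {m : ℕ} (a b : Fin m → V)
    (haa : ∀ i j, ¬ G.Adj (a i) (a j)) (hab : ∀ i, G.Adj (a i) (b i))
    (htri : ∀ i j, i < j → ¬ G.Adj (a i) (b j)) : m ≤ G.negInertia := by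
  obtain ⟨L, hL, -⟩ := exists_linearMap_of_triangular a b haa hab htri
  simpa using G.finrank_le_negInertia L fun y hy ↦ by
    have := (dotProduct_star_self_pos_iff (v := y)).mpr hy
    simp only [star_trivial] at this
    rw [hL]
    linarith

/-- A negative vector orthogonal to all the edges of a triangular family contributes one more
negative eigenvalue. -/
theorem succ_le_negInertia_of_triangular {m : ℕ} (a b : Fin m → V)
    (haa : ∀ i j, ¬ G.Adj (a i) (a j)) (hab : ∀ i, G.Adj (a i) (b i))
    (htri : ∀ i j, i < j → ¬ G.Adj (a i) (b j)) (z : V → ℝ)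
    (hza : ∀ i, (G.adjMatrix ℝ *ᵥ z) (a i) = 0) (hzb : ∀ i, (G.adjMatrix ℝ *ᵥ z) (b i) = 0)
    (hz : z ⬝ᵥ G.adjMatrix ℝ *ᵥ z < 0) : m + 1 ≤ G.negInertia := by
  obtain ⟨L, hL, hLu⟩ := exists_linearMap_of_triangular a b haa hab htri
  have key (y : Fin m → ℝ) (c : ℝ) :
      (L y + c • z) ⬝ᵥ G.adjMatrix ℝ *ᵥ (L y + c • z) =
        -(y ⬝ᵥ y) + c ^ 2 * (z ⬝ᵥ G.adjMatrix ℝ *ᵥ z) := by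
    have h1 : L y ⬝ᵥ G.adjMatrix ℝ *ᵥ z = 0 := hLu _ hza hzb y
    have h2 : z ⬝ᵥ G.adjMatrix ℝ *ᵥ L y = 0 := by
      rw [dotProduct_mulVec, ← mulVec_transpose, transpose_adjMatrix, dotProduct_comm, h1]
    simp only [mulVec_add, mulVec_smul, dotProduct_add, add_dotProduct, smul_dotProduct,
      dotProduct_smul, h1, h2, hL, smul_eq_mul]
    ring
  simpa using G.finrank_le_negInertia
    (L ∘ₗ LinearMap.fst ℝ (Fin m → ℝ) ℝ + (LinearMap.snd ℝ (Fin m → ℝ) ℝ).smulRight z)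
    fun ⟨y, c⟩ hyc ↦ by
      simp only [LinearMap.add_apply, LinearMap.comp_apply, LinearMap.fst_apply,
        LinearMap.smulRight_apply, LinearMap.snd_apply]
      rw [key]
      by_cases hy : y = 0
      · have hc : c ≠ 0 := by rintro rfl; exact hyc (by simp [hy])
        have : 0 < c ^ 2 := by positivity
        simp only [hy, dotProduct_zero, neg_zero, zero_add]
        exact mul_neg_of_pos_of_neg this hz
      · have := (dotProduct_star_self_pos_iff (v := y)).mpr hy
        simp only [star_trivial] at this
        nlinarith [sq_nonneg c]

end Triangular

/-! ### Shortest cycles -/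

theorem cycleGraph_adj_iff_val {n : ℕ} (hn : 2 ≤ n) {u v : Fin n} :
    (cycleGraph n).Adj u v ↔ u.val + 1 = v ∨ v.val + 1 = u ∨
      (u.val = 0 ∧ v.val + 1 = n) ∨ (v.val = 0 ∧ u.val + 1 = n) := by
  rw [cycleGraph_adj', Fin.val_sub, Fin.val_sub]
  obtain ⟨u, hu⟩ := u
  obtain ⟨v, hv⟩ := v
  simp only
  rcases lt_trichotomy u v with h | rfl | h
  · rw [Nat.mod_eq_of_lt (by omega : n - v + u < n), Nat.mod_eq_sub_mod (by omega),
      Nat.mod_eq_of_lt (by omega)]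
    omega
  · rw [show n - u + u = n by omega, Nat.mod_self]
    omega
  · rw [Nat.mod_eq_of_lt (by omega : n - u + v < n), Nat.mod_eq_sub_mod (by omega),
      Nat.mod_eq_of_lt (by omega)]
    omega

section

variable {V : Type*} {G : SimpleGraph V}

theorem Walk.IsPath.girth_le_length_add_one {u v : V} {p : G.Walk u v} (hp : p.IsPath)
    (h2 : 2 ≤ p.length) (h : G.Adj v u) : G.girth ≤ p.length + 1 := by
  have hc : (Walk.cons h p).IsCycle := by
    rw [Walk.isCycle_iff_isPath_tail_and_le_length]
    exact ⟨by simpa using hp, by simpa using h2⟩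
  simpa using girth_le_length hc

theorem not_adj_of_three_lt_girth (hg : 3 < G.girth) {x y z : V} (hxy : G.Adj x y)
    (hyz : G.Adj y z) : ¬ G.Adj x z := by
  intro hxz
  have hp : (Walk.cons hxy (Walk.cons hyz .nil)).IsPath := by
    simp [Walk.cons_isPath_iff, hxy.ne, hyz.ne, hxz.ne]
  have := hp.girth_le_length_add_one (by simp) hxz.symm
  simp only [Walk.length_cons, Walk.length_nil] at this
  omega

/-- A shortest cycle has no chord. -/
theorem Walk.IsCycle.eq_of_adj_getVert {u : V} {c : G.Walk u u} (hc : c.IsCycle)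
    (hg : c.length = G.girth) {i j : ℕ} (hij : i < j) (hj : j < c.length)
    (h : G.Adj (c.getVert i) (c.getVert j)) : i + 1 = j ∨ (i = 0 ∧ j + 1 = c.length) := by
  by_contra hne
  -- A chord closes the arc from `c i` to `c j` to a cycle of length `j - i + 1`.
  have hp : ((c.take j).drop i).IsPath := (hc.isPath_take hj).drop i
  have hstart : (c.take j).getVert i = c.getVert i := by simp [hij.le]
  have hlen : ((c.take j).drop i).length = j - i := by simp [hj.le]
  have := hp.girth_le_length_add_one (by omega) (hstart ▸ h.symm)
  omega

/-- A vertex outside a shortest cycle of length at least five has at most one neighbour on it. -/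
theorem Walk.IsCycle.not_adj_getVert {u : V} {c : G.Walk u u} (hc : c.IsCycle)
    (hg : c.length = G.girth) (h5 : 5 ≤ c.length) {w : V} (hw : w ∉ c.support)
    (hwu : G.Adj w u) {j : ℕ} (h0 : 0 < j) (hj : j < c.length) : ¬ G.Adj w (c.getVert j) := by
  intro h
  -- A second neighbour `c j` closes both arcs of the cycle through `w`, giving cycles of lengths
  -- `j + 2` and `g - j + 2`.
  have hp₁ : (Walk.cons hwu (c.take j)).IsPath :=
    (hc.isPath_take hj).cons fun hm ↦ hw ((c.isSubwalk_take j).support_subset hm)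
  have hp₂ : (Walk.cons h (c.drop j)).IsPath :=
    (hc.isPath_drop h0).cons fun hm ↦ hw ((c.isSubwalk_drop j).support_subset hm)
  have h₁ := hp₁.girth_le_length_add_one (by simp; omega) h.symm
  have h₂ := hp₂.girth_le_length_add_one (by simp; omega) hwu.symm
  simp only [Walk.length_cons, Walk.take_length, Walk.drop_length] at h₁ h₂
  omega

/-- A shortest cycle is an induced cycle. -/
theorem Walk.IsCycle.exists_embedding {u : V} {c : G.Walk u u} (hc : c.IsCycle)
    (hg : c.length = G.girth) :
    ∃ f : cycleGraph c.length ↪g G, ∀ i, f i = c.getVert i := by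
  have h3 := hc.three_le_length
  have hadj {i j : ℕ} (hij : i < j) (hj : j < c.length) :
      G.Adj (c.getVert i) (c.getVert j) ↔ i + 1 = j ∨ (i = 0 ∧ j + 1 = c.length) := by
    refine ⟨hc.eq_of_adj_getVert hg hij hj, ?_⟩
    rintro (rfl | ⟨rfl, hl⟩)
    · exact c.adj_getVert_succ (by omega)
    · have := c.adj_getVert_succ (i := j) hj
      rw [hl, c.getVert_length] at this
      simpa using this.symm
  refine ⟨⟨⟨fun i ↦ c.getVert i, fun i j hij ↦ ?_⟩, fun {i j} ↦ ?_⟩, fun _ ↦ rfl⟩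
  · have := hc.getVert_injOn' (Set.mem_ofPred.mpr (by omega)) (Set.mem_ofPred.mpr (by omega)) hij
    exact Fin.ext this
  · change G.Adj (c.getVert i) (c.getVert j) ↔ _
    rw [cycleGraph_adj_iff_val (by omega)]
    rcases lt_trichotomy i.val j.val with h | h | h
    · rw [hadj h j.2]
      omega
    · rw [h]
      simp
      omega
    · rw [G.adj_comm, hadj h i.2]
      omega

/-- A connected graph with a cycle is either a cycle, or has a shortest cycle with a vertex outside
it attached to its base point. -/
theorem Connected.iso_cycleGraph_or_exists_adj (hconn : G.Connected) (hcyc : ¬ G.IsAcyclic) :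
    Nonempty (G ≃g cycleGraph G.girth) ∨ ∃ (u : V) (c : G.Walk u u) (w : V), c.IsCycle ∧
      c.length = G.girth ∧ w ∉ c.support ∧ G.Adj w u := by
  classical
  obtain ⟨a, c, hc, hg⟩ := exists_girth_eq_length.mpr hcyc
  by_cases hall : ∀ v, v ∈ c.support
  · left
    obtain ⟨f, hf⟩ := hc.exists_embedding hg.symm
    rw [hg]
    refine ⟨RelIso.symm (RelIso.ofSurjective f fun v ↦ ?_)⟩
    obtain ⟨n, hn, hl⟩ := Walk.mem_support_iff_exists_getVert.mp (hall v)
    have h3 := hc.three_le_length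
    obtain hl | rfl := hl.lt_or_eq
    · exact ⟨⟨n, hl⟩, by rw [hf, hn]⟩
    · exact ⟨⟨0, by omega⟩, by rw [hf, ← hn]; simp⟩
  · right
    push Not at hall
    obtain ⟨v, hv⟩ := hall
    obtain ⟨p⟩ := hconn.preconnected a v
    obtain ⟨d, -, hd₁, hd₂⟩ := p.exists_boundary_dart {x | x ∈ c.support} c.start_mem_support hv
    refine ⟨d.fst, c.rotate d.fst hd₁, d.snd, by simpa using hc, by simp [hg], ?_, d.adj.symm⟩
    rwa [Walk.mem_support_rotate_iff]

end

/-! ### The negative inertia of cycles -/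

theorem _root_.Fin.sub_one_ne_add_one {n : ℕ} (v : Fin (n + 3)) : v - 1 ≠ v + 1 := by
  have h := cycleGraph_degree_three_le (v := v)
  rw [cycleGraph_degree_two_le] at h
  intro he
  simp [he] at h

/-- The adjacency form of the cycle on the vertices `0, …, m`. -/
theorem cycleGraph_dotProduct_adjMatrix_mulVec {m : ℕ} (hm : 2 ≤ m) (y : ℕ → ℝ) :
    (fun v : Fin (m + 1) ↦ y v) ⬝ᵥ (cycleGraph (m + 1)).adjMatrix ℝ *ᵥ (fun v ↦ y v) =
      2 * (∑ j ∈ Finset.range m, y j * y (j + 1) + y m * y 0) := by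
  obtain ⟨m, rfl⟩ := Nat.exists_eq_add_of_le' hm
  set x : Fin (m + 3) → ℝ := fun v ↦ y v
  have h1 : ∑ v, x v * x (v - 1) = ∑ v, x v * x (v + 1) := by
    rw [← Equiv.sum_comp (Equiv.addRight (1 : Fin (m + 3)))]
    simp [mul_comm]
  have h2 : ∑ v, x v * x (v + 1) =
      ∑ j ∈ Finset.range (m + 2), y j * y (j + 1) + y (m + 2) * y 0 := by
    rw [Fin.sum_univ_castSucc, Finset.sum_range]
    congr 1
    · refine Finset.sum_congr rfl fun i _ ↦ ?_
      rw [Fin.coeSucc_eq_succ]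
      simp [x]
    · simp [x]
  rw [← h2, two_mul]
  nth_rw 1 [← h1]
  rw [dotProduct, ← Finset.sum_add_distrib]
  refine Finset.sum_congr rfl fun v _ ↦ ?_
  rw [adjMatrix_mulVec_apply, cycleGraph_neighborFinset, Finset.sum_pair (Fin.sub_one_ne_add_one v), mul_add]

/-- On the vertices `0, 2, 4, …` let `y` alternate in sign; then the edges of the path
`0, 1, …, 2 * i` contribute nothing to the form, whatever the values at the odd vertices. -/
theorem sum_range_mul_succ_eq_zero {y : ℕ → ℝ} {i : ℕ}
    (h : ∀ j < i, y (2 * (j + 1)) = -y (2 * j)) :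
    ∑ j ∈ Finset.range (2 * i), y j * y (j + 1) = 0 := by
  induction i with
  | zero => simp
  | succ i ih =>
    rw [show 2 * (i + 1) = 2 * i + 1 + 1 by ring, Finset.sum_range_succ, Finset.sum_range_succ,
      ih fun j hj ↦ h j (by omega), show 2 * i + 1 + 1 = 2 * (i + 1) by ring, h i (by omega)]
    ring

theorem negInertia_cycleGraph_le {n : ℕ} (hn : 3 ≤ n) (h : n % 4 = 0 ∨ n % 4 = 1) :
    (cycleGraph n).negInertia ≤ (n - 1) / 2 := by
  obtain ⟨m, rfl⟩ : ∃ m, n = m + 1 := ⟨n - 1, by omega⟩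
  simp only [Nat.add_sub_cancel]
  -- The kernel of `φ` consists of the vectors that alternate in sign along `0, 2, 4, …`.
  let φ : (Fin (m + 1) → ℝ) →ₗ[ℝ] Fin (m / 2) → ℝ :=
    { toFun x i := x ⟨2 * (i + 1), by omega⟩ + x ⟨2 * i, by omega⟩
      map_add' x y := by ext i; simp only [Pi.add_apply]; ring
      map_smul' c x := by ext i; simp only [Pi.smul_apply, smul_eq_mul, RingHom.id_apply]; ring }
  refine negInertia_le_of_ker _ φ fun x hx ↦ ?_
  let y : ℕ → ℝ := fun j ↦ if hj : j < m + 1 then x ⟨j, hj⟩ else 0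
  have hxy : x = fun v : Fin (m + 1) ↦ y v := by
    ext v
    simp only [y, v.2, dif_pos]
  have hy : ∀ j < m / 2, y (2 * (j + 1)) = -y (2 * j) := by
    intro j hj
    have := congrFun hx ⟨j, hj⟩
    simp only [φ, LinearMap.coe_mk, AddHom.coe_mk, Pi.zero_apply] at this
    have h1 : 2 * (j + 1) < m + 1 := by omega
    have h2 : 2 * j < m + 1 := by omega
    simp only [y, h1, h2, dif_pos]
    linarith
  have hpow : ∀ j ≤ m / 2, y (2 * j) = (-1) ^ j * y 0 := by
    intro j hj
    induction j with
    | zero => simp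
    | succ j ih => rw [hy j (by omega), ih (by omega)]; ring
  have hs := sum_range_mul_succ_eq_zero hy
  rw [hxy, cycleGraph_dotProduct_adjMatrix_mulVec (by omega)]
  have hlast := hpow (m / 2) le_rfl
  rcases h with h | h
  -- Only the edges beyond the path `0, …, 2 * (m / 2)` remain. For even `m + 1` they are the two
  -- edges at the vertex `m`, and cancel; for odd `m + 1` the edge `{m, 0}` contributes `y 0 ^ 2`.
  · have hm : m = 2 * (m / 2) + 1 := by omega
    have hodd : Odd (m / 2) := Nat.odd_iff.mpr (by omega)
    rw [hodd.neg_one_pow] at hlast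
    rw [show Finset.range m = Finset.range (2 * (m / 2) + 1) by rw [← hm], Finset.sum_range_succ,
      hs, ← hm, hlast]
    linarith
  · have hm : m = 2 * (m / 2) := by omega
    have heven : Even (m / 2) := Nat.even_iff.mpr (by omega)
    rw [heven.neg_one_pow, ← hm] at hlast
    rw [← hm] at hs
    rw [hs, hlast]
    nlinarith [mul_self_nonneg (y 0)]

theorem le_negInertia_cycleGraph {n : ℕ} (hn : 3 ≤ n) :
    (n - 1) / 2 ≤ (cycleGraph n).negInertia := by
  refine le_negInertia_of_triangular (fun i : Fin ((n - 1) / 2) ↦ ⟨2 * i + 1, by omega⟩)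
    (fun i ↦ ⟨2 * i + 2, by omega⟩) (fun i j ↦ ?_) (fun i ↦ ?_) (fun i j hij ↦ ?_)
  · rw [cycleGraph_adj_iff_val (by omega)]
    simp only
    omega
  · rw [cycleGraph_adj_iff_val (by omega)]
    exact Or.inl rfl
  · rw [cycleGraph_adj_iff_val (by omega)]
    simp only
    omega

/-- The periodic sign pattern `1, -1, -1, 1, 1, -1, -1, 1, …` is orthogonal to the edges
`{1, 2}, {3, 4}, …` of the cycle, and the form is negative on it when `n % 4` is `2` or `3`. -/
theorem lt_negInertia_cycleGraph {n : ℕ} (hn : 3 ≤ n) (h : n % 4 = 2 ∨ n % 4 = 3) :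
    (n - 1) / 2 < (cycleGraph n).negInertia := by
  obtain ⟨m, rfl⟩ : ∃ m, n = m + 1 := ⟨n - 1, by omega⟩
  simp only [Nat.add_sub_cancel]
  let y : ℕ → ℝ := fun j ↦ (-1) ^ ((j + 1) / 2)
  have hy2 (j : ℕ) : y (j + 2) = -y j := by
    simp only [y]
    rw [show (j + 2 + 1) / 2 = (j + 1) / 2 + 1 by omega, pow_succ]
    ring
  have hy0 : y 0 = 1 := by simp [y]
  have heven (i : ℕ) : y (2 * i) = (-1) ^ i := by
    simp only [y]
    congr 1
    omega
  have hodd (i : ℕ) : y (2 * i + 1) = (-1) ^ (i + 1) := by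
    simp only [y]
    congr 1
    omega
  have hs (i : ℕ) : ∑ j ∈ Finset.range (2 * i), y j * y (j + 1) = 0 :=
    sum_range_mul_succ_eq_zero fun j _ ↦ hy2 (2 * j)
  have hz (v : Fin (m + 1)) (hv0 : v.val ≠ 0) (hv : v.val < m ∨ m % 4 = 2) :
      ((cycleGraph (m + 1)).adjMatrix ℝ *ᵥ fun v ↦ y v) v = 0 := by
    obtain ⟨l, rfl⟩ := Nat.exists_eq_add_of_le' (show 2 ≤ m by omega)
    have hpred : (v - 1).val = v.val - 1 := by
      rw [Fin.val_sub_one_of_ne_zero (Fin.val_ne_zero_iff.mp hv0)]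
    rw [adjMatrix_mulVec_apply, cycleGraph_neighborFinset, Finset.sum_pair (Fin.sub_one_ne_add_one v), hpred]
    obtain hlt | hle := lt_or_ge v.val (l + 2)
    · rw [Fin.val_add_one_of_lt (Fin.lt_def.mpr (by simpa using hlt)),
        show v.val + 1 = v.val - 1 + 2 by omega, hy2, add_neg_cancel]
    · have hv' : v = Fin.last (l + 2) := Fin.ext (by simp; omega)
      obtain ⟨k, rfl⟩ : ∃ k, l = 2 * (2 * k) := ⟨l / 4, by omega⟩
      rw [hv', Fin.last_add_one]
      simp only [Fin.val_last, Fin.val_zero, hy0]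
      rw [Nat.add_sub_assoc (by omega), hodd]
      simp [pow_succ, pow_mul]
  refine succ_le_negInertia_of_triangular (fun i : Fin (m / 2) ↦ ⟨2 * i + 1, by omega⟩)
    (fun i ↦ ⟨2 * i + 2, by omega⟩) (fun i j ↦ ?_) (fun i ↦ ?_) (fun i j hij ↦ ?_)
    (fun v ↦ y v) (fun i ↦ ?_) (fun i ↦ ?_) ?_
  · rw [cycleGraph_adj_iff_val (by omega)]
    simp only
    omega
  · rw [cycleGraph_adj_iff_val (by omega)]
    exact Or.inl rfl
  · rw [cycleGraph_adj_iff_val (by omega)]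
    simp only
    omega
  · exact hz _ (by simp) (by simp only; omega)
  · exact hz _ (by simp) (by simp only; omega)
  rw [cycleGraph_dotProduct_adjMatrix_mulVec (by omega)]
  rcases h with h | h
  · obtain ⟨k, rfl⟩ : ∃ k, m = 2 * (2 * k) + 1 := ⟨m / 4, by omega⟩
    rw [Finset.sum_range_succ, hs, hodd, heven, hy0]
    norm_num [pow_succ, pow_mul]
  · obtain ⟨k, rfl⟩ : ∃ k, m = 2 * (2 * k + 1) := ⟨m / 4, by omega⟩
    rw [hs, heven, hy0]
    simp [pow_succ, pow_mul]

/-! ### A vertex attached to a long shortest cycle -/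

section

variable {V : Type*} [Fintype V] [DecidableEq V] {G : SimpleGraph V} [DecidableRel G.Adj]

/-- With `w` attached to the base point `c 0` of the cycle `c`, the edges `{w, c 0}`, `{c 1, c 2}`,
`{c 3, c 4}`, … form a triangular family with one edge more than the cycle alone provides. -/
theorem Walk.IsCycle.lt_negInertia_of_adj {u w : V} {c : G.Walk u u} (hc : c.IsCycle)
    (hg : c.length = G.girth) (h5 : 5 ≤ c.length) (hw : w ∉ c.support) (hwu : G.Adj w u) :
    (c.length - 1) / 2 < G.negInertia := by
  have hadj {i j : ℕ} (hi : i < c.length) (hj : j < c.length) :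
      G.Adj (c.getVert i) (c.getVert j) ↔ i + 1 = j ∨ j + 1 = i ∨
        (i = 0 ∧ j + 1 = c.length) ∨ (j = 0 ∧ i + 1 = c.length) := by
    obtain ⟨f, hf⟩ := hc.exists_embedding hg
    rw [← cycleGraph_adj_iff_val (by omega) (u := ⟨i, hi⟩) (v := ⟨j, hj⟩), ← f.map_adj_iff, hf, hf]
  have hwc {j : ℕ} (h0 : 0 < j) (hj : j < c.length) : ¬ G.Adj w (c.getVert j) :=
    hc.not_adj_getVert hg h5 hw hwu h0 hj
  set m := (c.length - 1) / 2 with hm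
  let a : Fin (m + 1) → V := Fin.cons w fun i ↦ c.getVert (2 * i + 1)
  let b : Fin (m + 1) → V := fun i ↦ c.getVert (2 * i)
  refine le_negInertia_of_triangular a b (fun i j ↦ ?_) (fun i ↦ ?_) (fun i j hij ↦ ?_)
  · induction i using Fin.cases with
    | zero =>
      induction j using Fin.cases with
      | zero => exact G.loopless.irrefl w
      | succ j => exact hwc (by omega) (by omega)
    | succ i =>
      induction j using Fin.cases with
      | zero => exact fun h ↦ hwc (by omega) (by omega) h.symm
      | succ j =>
        simp only [a, Fin.cons_succ]
        rw [hadj (by omega) (by omega)]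
        omega
  · induction i using Fin.cases with
    | zero => simpa [a, b] using hwu
    | succ i =>
      simp only [a, b, Fin.cons_succ, Fin.val_succ]
      rw [hadj (by omega) (by omega)]
      omega
  · induction i using Fin.cases with
    | zero => exact hwc (by have := Fin.lt_def.mp hij; simp at this; omega) (by omega)
    | succ i =>
      have := Fin.lt_def.mp hij
      simp only [Fin.val_succ] at this
      simp only [a, b, Fin.cons_succ]
      rw [hadj (by omega) (by omega)]
      omega

/-! ### Complete bipartite graphs -/

theorem negInertia_le_one_of_iso_completeBipartiteGraph {α β : Type*} [Fintype α] [Fintype β]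
    (f : G ≃g completeBipartiteGraph α β) : G.negInertia ≤ 1 := by
  classical
  rw [negInertia_eq_of_iso f]
  let φ : (α ⊕ β → ℝ) →ₗ[ℝ] Fin 1 → ℝ :=
    { toFun x _ := ∑ i, x (.inl i) - ∑ j, x (.inr j)
      map_add' x y := by ext; simp only [Pi.add_apply, Finset.sum_add_distrib]; ring
      map_smul' r x := by
        ext
        simp only [Pi.smul_apply, smul_eq_mul, RingHom.id_apply, ← Finset.mul_sum]
        ring }
  refine negInertia_le_of_ker _ φ fun x hx ↦ ?_
  have hx' : ∑ i, x (.inl i) = ∑ j, x (.inr j) := sub_eq_zero.mp (congrFun hx 0)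
  have : x ⬝ᵥ (completeBipartiteGraph α β).adjMatrix ℝ *ᵥ x =
      2 * ((∑ i, x (.inl i)) * ∑ j, x (.inr j)) := by
    simp only [dotProduct, mulVec, adjMatrix_apply, Fintype.sum_sum_type]
    simp [← Finset.sum_mul]
    ring
  rw [this, hx']
  nlinarith [mul_self_nonneg (∑ j, x (.inr j))]

/-- With a single negative eigenvalue every vertex has a neighbour on every edge; without triangles
that neighbour is unique, so the ends of any edge split the graph into two independent sets. -/
theorem exists_iso_completeBipartiteGraph (hconn : G.Connected) (hg : 3 < G.girth)
    (hn : G.negInertia ≤ 1) {p q : V} (hpq : G.Adj p q) :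
    ∃ s t : ℕ, 1 ≤ s ∧ 1 ≤ t ∧ s + t = Fintype.card V ∧
      Nonempty (G ≃g completeBipartiteGraph (Fin s) (Fin t)) := by
  have : Nontrivial V := ⟨p, q, hpq.ne⟩
  have hor {x p q : V} (hpq : G.Adj p q) (hxp : ¬ G.Adj x p) : G.Adj x q := by
    by_contra hxq
    obtain ⟨y, hxy⟩ := hconn.preconnected.exists_adj_of_nontrivial x
    have := le_negInertia_of_triangular (G := G) ![x, p] ![y, q]
      (by simp [Fin.forall_fin_two, hxp, G.adj_comm p x]) (by simp [Fin.forall_fin_two, hxy, hpq])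
      (by simp [Fin.forall_fin_two, hxq])
    omega
  let e : V ≃ {x // G.Adj x p} ⊕ {x // ¬ G.Adj x p} := (Equiv.sumCompl _).symm
  have hadj (x y : V) : G.Adj x y ↔ (G.Adj x p ↔ ¬ G.Adj y p) := by
    by_cases hx : G.Adj x p <;> by_cases hy : G.Adj y p
    · simpa [hx, hy] using not_adj_of_three_lt_girth hg hx hy.symm
    · simp only [hx, hy, not_false_iff, iff_true]
      have hyq := hor hpq hy
      refine hor hyq.symm fun hxq ↦ ?_
      exact not_adj_of_three_lt_girth hg hx hpq hxq
    · simp only [hx, hy, not_true, iff_true]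
      have hxq := hor hpq hx
      refine (hor hxq.symm fun hyq ↦ ?_).symm
      exact not_adj_of_three_lt_girth hg hy hpq hyq
    · simpa [hx, hy] using not_adj_of_three_lt_girth hg (hor hpq hx) (hor hpq hy).symm
  let f : G ≃g completeBipartiteGraph {x // G.Adj x p} {x // ¬ G.Adj x p} :=
    ⟨e, fun {x y} ↦ by
      rw [hadj]
      by_cases hx : G.Adj x p <;> by_cases hy : G.Adj y p <;>
        simp [e, hx, hy, Equiv.sumCompl_symm_apply_of_pos, Equiv.sumCompl_symm_apply_of_neg]⟩
  refine ⟨Fintype.card {x // G.Adj x p}, Fintype.card {x // ¬ G.Adj x p},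
    Fintype.card_pos_iff.mpr ⟨⟨q, hpq.symm⟩⟩, Fintype.card_pos_iff.mpr ⟨⟨p, G.loopless.irrefl p⟩⟩,
    by rw [← Fintype.card_sum, Fintype.card_congr e], ⟨f.trans ?_⟩⟩
  exact completeBipartiteGraphCongr (Fintype.equivFin _) (Fintype.equivFin _)

end

end SimpleGraph

/-! ### The bound and its equality case -/

open SimpleGraph

theorem theorem3p6 {V : Type*} [Fintype V] [DecidableEq V] (G : SimpleGraph V)
    [DecidableRel G.Adj] (hconn : G.Connected) (hcyc : ¬ G.IsAcyclic) :
    ⌈(G.girth : ℝ) / 2⌉ - 1 ≤ (G.negInertia : ℤ) ∧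
    ((G.negInertia : ℤ) = ⌈(G.girth : ℝ) / 2⌉ - 1 ↔
      (∃ n : ℕ, 3 ≤ n ∧ (n % 4 = 0 ∨ n % 4 = 1) ∧
        Nonempty (G ≃g SimpleGraph.cycleGraph n)) ∨
      (∃ s t : ℕ, 1 ≤ s ∧ 1 ≤ t ∧ 5 ≤ s + t ∧
        Nonempty (G ≃g completeBipartiteGraph (Fin s) (Fin t)))) := by
  have h3 : 3 ≤ G.girth := three_le_girth hcyc
  have hceil : ⌈(G.girth : ℝ) / 2⌉ - 1 = (((G.girth - 1) / 2 : ℕ) : ℤ) := by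
    rw [sub_eq_iff_eq_add, Int.ceil_eq_iff]
    set k := (G.girth - 1) / 2 with hk
    have h₁ : 2 * k + 1 ≤ G.girth := by omega
    have h₂ : G.girth ≤ 2 * k + 2 := by omega
    have h₁' : 2 * (k : ℝ) + 1 ≤ G.girth := by exact_mod_cast h₁
    have h₂' : (G.girth : ℝ) ≤ 2 * k + 2 := by exact_mod_cast h₂
    push_cast
    constructor <;> linarith
  rw [hceil, Nat.cast_le, Nat.cast_inj]
  have hcycle : (cycleGraph G.girth).negInertia ≤ G.negInertia := by
    obtain ⟨a, c, hc, hg⟩ := exists_girth_eq_length.mpr hcyc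
    obtain ⟨f, -⟩ := hc.exists_embedding hg.symm
    rw [hg]
    exact negInertia_le_of_embedding f
  have hle : (G.girth - 1) / 2 ≤ G.negInertia := (le_negInertia_cycleGraph h3).trans hcycle
  refine ⟨hle, fun heq ↦ ?_, ?_⟩
  · have hmod : G.girth % 4 = 0 ∨ G.girth % 4 = 1 := by
      by_contra h
      have := lt_negInertia_cycleGraph h3 (by omega)
      omega
    obtain hiso | ⟨u, c, w, hc, hg, hw, hwu⟩ := hconn.iso_cycleGraph_or_exists_adj hcyc
    · exact Or.inl ⟨_, h3, hmod, hiso⟩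
    · right
      have h4 : G.girth = 4 := by
        by_contra h
        have := hc.lt_negInertia_of_adj hg (by omega) hw hwu
        omega
      obtain ⟨s, t, hs, ht, hst, hiso⟩ :=
        exists_iso_completeBipartiteGraph hconn (by omega) (by omega) hwu
      refine ⟨s, t, hs, ht, ?_, hiso⟩
      obtain ⟨f, hf⟩ := hc.exists_embedding hg
      have hlt := Fintype.card_lt_of_injective_of_notMem f f.injective (b := w) (by
        rintro ⟨i, rfl⟩
        rw [hf] at hw
        exact hw (c.getVert_mem_support i))
      rw [Fintype.card_fin] at hlt
      omega
  · rintro (⟨n, hn, hmod, ⟨f⟩⟩ | ⟨s, t, -, -, -, ⟨f⟩⟩)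
    · -- A vertex attached to a shortest cycle would have degree at least three.
      have hgn : G.girth = n := by
        obtain ⟨⟨e⟩⟩ | ⟨u, c, w, hc, hg, hw, hwu⟩ := hconn.iso_cycleGraph_or_exists_adj hcyc
        · simpa using Fintype.card_congr (e.symm.trans f).toEquiv
        · exfalso
          obtain ⟨n, rfl⟩ := Nat.exists_eq_add_of_le' hn
          have hdeg : G.degree u = 2 := by
            rw [← f.degree_eq u, cycleGraph_degree_three_le]
          have hsub : {w, c.snd, c.penultimate} ⊆ G.neighborFinset u := by
            simp [Finset.insert_subset_iff, hwu.symm, c.adj_snd hc.not_nil,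
              (c.adj_penultimate hc.not_nil).symm]
          have hcard := Finset.card_le_card hsub
          rw [G.card_neighborFinset_eq_degree, hdeg, Finset.card_eq_three.mpr
            ⟨_, _, _, ?_, ?_, hc.snd_ne_penultimate, rfl⟩] at hcard
          · omega
          · rintro rfl
            exact hw (c.getVert_mem_support _)
          · rintro rfl
            exact hw (c.getVert_mem_support _)
      refine le_antisymm ?_ hle
      rw [negInertia_eq_of_iso f, hgn]
      exact negInertia_cycleGraph_le hn hmod
    · -- A triangle would force two negative eigenvalues, and so would a girth above four.
      have h1 := negInertia_le_one_of_iso_completeBipartiteGraph f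
      have hne : G.girth ≠ 3 := by
        intro h
        have := lt_negInertia_cycleGraph h3 (by omega)
        omega
      omega
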